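/- Let $X=\ell_1$ be the complex Banach space of absolutely summable sequences $(x_n)_{n\in\mathbb N}$, with open unit ball $B$. Let $A_\infty(B)$ be the algebra, with the supremum norm, of all bounded holomorphic functions on $B$ that extend continuously to $\bar B$; let $A_u(B)\subset A_\infty(B)$ be the subalgebra of bounded holomorphic functions that are uniformly continuous on $B$; let $M$ be the spectrum of $A_\infty(B)$, i.e. the set of nonzero multiplicative linear functionals on $A_\infty(B)$, and write $\hat f(\tau)=\tau(f)$ for the Gelfand transform of $f\in A_\infty(B)$. Let $P(X)$ be the set of continuous polynomials on $X$. For $P\in P(X)$ let $\tilde P$ be its Aron–Berner extension to $X^{**}$ (extend each variable of the associated symmetric multilinear forms, one at a time, to $X^{**}$ by weak-star continuity and restrict to the diagonal), and for $g\in A_u(B)$ let $\tilde g$ be its Aron–Berner extension to $\bar B^{**}$ (the sum, on the open unit ball of $X^{**}$, of the Aron–Berner extensions of the terms of the Taylor series of $g$ at $0$, extended continuously to the closed ball). For $z\in\bar B^{**}$ and $f\in A_\infty(B)$ put $$Cl_B(f,z)=\{\lambda:\ \exists \text{ a net }(x_\alpha)\subset B,\ \varphi(x_\alpha)\to z(\varphi)\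 \text{for all }\varphi\in X^*,\ f(x_\alpha)\to\lambda\},$$ $$Cl_B^{\mathcal P}(f,z)=\{\lambda:\ \exists \text{ a net }(x_\alpha)\subset B,\ P(x_\alpha)\to \tilde P(z)\ \text{for all }P\in P(X),\ f(x_\alpha)\to\lambda\},$$ $$M_z=\{\tau\in M:\ \tau(\varphi|_B)=z(\varphi)\ \text{for all }\varphi\in X^*\},\qquad M_z^{\mathcal P}=\{\tau\in M:\ \tau(g)=\tilde g(z)\ \text{for all }g\in A_u(B)\}.$$ Then for every $x\in\ell_1$ with $\|x\|=1$, regarded as a point of $X^{**}$, both the polynomial and the original cluster value theorems hold for $A_\infty(B)$ at $x$: for all $f\in A_\infty(B)$, $$Cl_B^{\mathcal P}(f,x)=\hat f(M_x^{\mathcal P})\qquad\text{and}\qquad Cl_B(f,x)=\hat f(M_x).$$ -/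

import Mathlib

open Filter Topology
open scoped BoundedContinuousFunction

noncomputable section

namespace ClusterValue

variable (X : Type*) [NormedAddCommGroup X] [NormedSpace ℂ X]

/-- The open unit ball `B` of `X`, as a type. -/
abbrev Ball : Type _ := ↥(Metric.ball (0 : X) 1)

variable {X}

/-- Extension by zero to `X` of a function on the open unit ball. Only its behaviour on the (open)
ball is ever used; it lets us speak of analyticity and derivatives of functions defined on `B`. -/
def zeroExt (f : Ball X → ℂ) : X → ℂ := fun x =>
  haveI := Classical.propDecidable (x ∈ Metric.ball (0 : X) 1)
  if h : x ∈ Metric.ball (0 : X) 1 then f ⟨x, h⟩ else 0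

/-- `f` is holomorphic on the open unit ball: it has a convergent power series expansion (in
continuous homogeneous polynomials) around each point of the ball. -/
def IsHolomorphic (f : Ball X → ℂ) : Prop :=
  AnalyticOnNhd ℂ (zeroExt f) (Metric.ball (0 : X) 1)

set_option linter.unusedSectionVars false in
theorem zeroExt_of_mem (f : Ball X → ℂ) {x : X} (h : x ∈ Metric.ball (0 : X) 1) :
    zeroExt f x = f ⟨x, h⟩ := by
  simp only [zeroExt, dif_pos h]

theorem IsHolomorphic.congr {f : Ball X → ℂ} {F : X → ℂ}
    (hF : AnalyticOnNhd ℂ F (Metric.ball (0 : X) 1)) (h : ∀ x : Ball X, f x = F x) :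
    IsHolomorphic f :=
  hF.congr Metric.isOpen_ball fun x hx => by rw [zeroExt_of_mem f hx, h]

theorem IsHolomorphic.const (c : ℂ) : IsHolomorphic (fun _ : Ball X => c) :=
  IsHolomorphic.congr (F := fun _ => c) analyticOnNhd_const fun _ => rfl

theorem IsHolomorphic.add {f g : Ball X → ℂ} (hf : IsHolomorphic f) (hg : IsHolomorphic g) :
    IsHolomorphic (fun x => f x + g x) :=
  IsHolomorphic.congr (AnalyticOnNhd.add hf hg) fun x => by
    simp [zeroExt_of_mem _ x.2]

theorem IsHolomorphic.mul {f g : Ball X → ℂ} (hf : IsHolomorphic f) (hg : IsHolomorphic g) :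
    IsHolomorphic (fun x => f x * g x) :=
  IsHolomorphic.congr (AnalyticOnNhd.mul hf hg) fun x => by
    simp [zeroExt_of_mem _ x.2]

variable (X)

/-- The algebra `A_∞(B)` of bounded holomorphic functions on the open unit ball `B` of `X` which
extend continuously to the closed unit ball, with the supremum norm. -/
def AInfty : Subalgebra ℂ (Ball X →ᵇ ℂ) where
  carrier := {f | IsHolomorphic (f : Ball X → ℂ) ∧
    ∃ F : X → ℂ, ContinuousOn F (Metric.closedBall (0 : X) 1) ∧ ∀ x : Ball X, F x = f x}
  mul_mem' := by
    rintro f g ⟨hf, F, hF, hFf⟩ ⟨hg, G, hG, hGg⟩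
    exact ⟨hf.mul hg, fun x => F x * G x, hF.mul hG, fun x => by simp [hFf, hGg]⟩
  add_mem' := by
    rintro f g ⟨hf, F, hF, hFf⟩ ⟨hg, G, hG, hGg⟩
    exact ⟨hf.add hg, fun x => F x + G x, hF.add hG, fun x => by simp [hFf, hGg]⟩
  algebraMap_mem' := fun c =>
    ⟨IsHolomorphic.const c, fun _ => c, continuousOn_const, fun _ => rfl⟩

variable {X}

/-- Membership in `A_u(B)`: the bounded function `f` on the open unit ball is holomorphic and
uniformly continuous. -/
def IsAu (f : Ball X →ᵇ ℂ) : Prop :=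
  IsHolomorphic (f : Ball X → ℂ) ∧ UniformContinuous (f : Ball X → ℂ)

variable (X)

/-- A continuous polynomial on `X`: a finite sum of continuous homogeneous polynomials
`x ↦ A_k (x, …, x)`, each given by its associated symmetric continuous `k`-linear form. -/
structure ContPolynomial where
  /-- a bound for the degree -/
  degBound : ℕ
  /-- the `k`-linear form associated with the homogeneous part of degree `k` -/
  form : ∀ k : ℕ, ContinuousMultilinearMap ℂ (fun _ : Fin k => X) ℂ
  /-- the forms are symmetric -/
  symm : ∀ (k : ℕ) (σ : Equiv.Perm (Fin k)) (v : Fin k → X),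
    form k (fun i => v (σ i)) = form k v

variable {X}

/-- The value of a polynomial at a point of `X`. -/
def ContPolynomial.eval (P : ContPolynomial X) (x : X) : ℂ :=
  ∑ k ∈ Finset.range (P.degBound + 1), P.form k (fun _ => x)

/-- The bidual `X**`. -/
abbrev Bidual (X : Type*) [NormedAddCommGroup X] [NormedSpace ℂ X] : Type _ :=
  StrongDual ℂ (StrongDual ℂ X)

/-- The Arens extension of a continuous `n`-linear form `A` on `X`, evaluated at the diagonal
point `(z, …, z)` with `z` in the bidual: the variables are extended to the bidual one at a time by
weak-star continuity, i.e. `Ã (z, …, z) = z (x ↦ (A (x, ·, …, ·))~ (z, …, z))`. -/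
def arensDiag (z : Bidual X) :
    ∀ n : ℕ, ContinuousMultilinearMap ℂ (fun _ : Fin n => X) ℂ →L[ℂ] ℂ
  | 0 => ContinuousMultilinearMap.apply ℂ (fun _ : Fin 0 => X) ℂ (fun _ => 0)
  | n + 1 =>
    (z.comp (ContinuousLinearMap.compL ℂ X
        (ContinuousMultilinearMap ℂ (fun _ : Fin n => X) ℂ) ℂ (arensDiag z n))).comp
      (continuousMultilinearCurryLeftEquiv ℂ (fun _ : Fin (n + 1) => X)
        ℂ).toContinuousLinearEquiv.toContinuousLinearMap

/-- The Aron-Berner extension of a continuous polynomial, evaluated at a point of the bidual. -/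
def ContPolynomial.aronBerner (P : ContPolynomial X) (z : Bidual X) : ℂ :=
  ∑ k ∈ Finset.range (P.degBound + 1), arensDiag z k (P.form k)

/-- `w` is the value at the point `z` of the closed unit ball of the bidual of the Aron-Berner
extension of the function `g` on the open unit ball. Inside the open ball of the bidual the
extension is the sum of the Aron-Berner extensions of the terms of the Taylor series of `g` at `0`
(the term of degree `k` comes from the symmetric form `iteratedFDeriv ℂ k g 0 / k!`); its
continuous extension to the boundary is obtained as a radial limit. -/
def IsAronBernerValue (g : Ball X → ℂ) (z : Bidual X) (w : ℂ) : Prop :=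
  ∃ G : ℝ → ℂ,
    (∀ r : ℝ, 0 ≤ r → r < 1 →
      HasSum (fun k : ℕ => (k.factorial : ℂ)⁻¹ *
        arensDiag ((r : ℂ) • z) k (iteratedFDeriv ℂ k (zeroExt g) 0)) (G r)) ∧
    Tendsto G (𝓝[<] 1) (𝓝 w)

/-- The cluster set of `f` at the point `z` of the bidual: the limits of `f` along nets (filters)
in the ball which converge weak-star to `z`. -/
def clusterSet (f : Ball X → ℂ) (z : Bidual X) : Set ℂ :=
  {c | ∃ l : Filter (Ball X), l.NeBot ∧
    (∀ φ : StrongDual ℂ X, Tendsto (fun x : Ball X => φ (x : X)) l (𝓝 (z φ))) ∧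
    Tendsto f l (𝓝 c)}

/-- The polynomial cluster set of `f` at the point `z` of the bidual: the limits of `f` along nets
(filters) in the ball which converge to `z` in the polynomial-star topology. -/
def polyClusterSet (f : Ball X → ℂ) (z : Bidual X) : Set ℂ :=
  {c | ∃ l : Filter (Ball X), l.NeBot ∧
    (∀ P : ContPolynomial X,
      Tendsto (fun x : Ball X => P.eval (x : X)) l (𝓝 (P.aronBerner z))) ∧
    Tendsto f l (𝓝 c)}

/-- The fiber over `z` of the spectrum of the algebra `H`: the characters whose restriction to the
continuous linear functionals is evaluation at `z`. -/
def fiber (H : Subalgebra ℂ (Ball X →ᵇ ℂ)) (z : Bidual X) :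
    Set (WeakDual.characterSpace ℂ H) :=
  {τ | ∀ (g : H) (φ : StrongDual ℂ X),
    (∀ x : Ball X, (g : Ball X →ᵇ ℂ) x = φ (x : X)) → τ g = z φ}

/-- The polynomial fiber over `z` of the spectrum of the algebra `H`: the characters whose
restriction to `A_u(B)` is evaluation of the Aron-Berner extension at `z`. -/
def polyFiber (H : Subalgebra ℂ (Ball X →ᵇ ℂ)) (z : Bidual X) :
    Set (WeakDual.characterSpace ℂ H) :=
  {τ | ∀ g : H, IsAu (g : Ball X →ᵇ ℂ) →
    IsAronBernerValue ((g : Ball X →ᵇ ℂ) : Ball X → ℂ) z (τ g)}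

/-- The cluster value theorem for `H` at `z`: for all `f` in `H`, the cluster set of `f` at `z` is
the image under the Gelfand transform of `f` of the fiber over `z`. -/
def ClusterValueTheoremAt (H : Subalgebra ℂ (Ball X →ᵇ ℂ)) (z : Bidual X) : Prop :=
  ∀ f : H, clusterSet ((f : Ball X →ᵇ ℂ) : Ball X → ℂ) z =
    WeakDual.gelfandTransform ℂ H f '' fiber H z

/-- The polynomial cluster value theorem for `H` at `z`: for all `f` in `H`, the polynomial cluster
set of `f` at `z` is the image under the Gelfand transform of `f` of the polynomial fiber. -/
def PolyClusterValueTheoremAt (H : Subalgebra ℂ (Ball X →ᵇ ℂ)) (z : Bidual X) : Prop :=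
  ∀ f : H, polyClusterSet ((f : Ball X →ᵇ ℂ) : Ball X → ℂ) z =
    WeakDual.gelfandTransform ℂ H f '' polyFiber H z

end ClusterValue

/-- The complex Banach space `ℓ_1`. -/
abbrev EllOne : Type := ↥(lp (fun _ : ℕ => ℂ) 1)

end

/-!
The point of the proof is that at a unit vector `x` of `ℓ_1` everything collapses to one value:
both cluster sets of `f` at `x`, and both images of the fibers under the Gelfand transform, are
`{F x}`, where `F` is the continuous extension of `f` to the closed ball (`boundaryEval`).

That `F x` belongs to all four sets is true at each point of the closed unit ball of each `X`. It is
the limit of `f` along norm convergence to `x`, and evaluation at `x` is a character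
(`boundaryChar`). This character lies in the polynomial fiber because the Aron-Berner extension
agrees with the function on `X` itself: along the radius to `x` it is the Taylor series at `0`,
which converges to `f` by the one-variable theorem (`isAronBernerValue_inclusion_iff`).

For the converse inclusions, the ball of `ℓ_1` has for each `ε` a polynomial `p` in finitely many
linear functionals with `p x = 0`, `re p ≥ 0` on `B`, and `re p` bounded below on `B` at distance at
least `ε` from `x` (`EllOne.hasPeakingPolynomials`). With unimodular `c n` such that
`c n * x n = ‖x n‖`, it is
`p y = 1 - ∑' n, c n * y n + 1 / 4 * ∑ n < N, (c n * y n - ‖x n‖) ^ 2`,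
where the linear part isolates a face of the ball and the squares isolate `x` in that face. Such a
`p` tends to `0` along every weakly convergent net, which is thus norm convergent
(`HasPeakingPolynomials.le_ballNhds`); and it is annihilated by each character `τ` of the fiber, so
`g = 1 / (1 + K p)` has `τ g = 1` while `g * (f - F x)` is uniformly small for large `K`, which
gives `τ f = F x` (`HasPeakingPolynomials.apply_eq`).
-/

noncomputable section

namespace ClusterValue

variable {X : Type*} [NormedAddCommGroup X] [NormedSpace ℂ X]

/-! ### Boundary values, linear elements and units of `A_∞(B)` -/

/-- The neighbourhoods of `x`, traced on the open unit ball. -/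
def ballNhds (x : X) : Filter (Ball X) := comap (fun y : Ball X => (y : X)) (𝓝 x)

omit [NormedSpace ℂ X] in
theorem tendsto_coe_ballNhds (x : X) :
    Tendsto (fun y : Ball X => (y : X)) (ballNhds x) (𝓝 x) := tendsto_comap

theorem ballNhds_neBot {x : X} (hx : x ∈ Metric.closedBall (0 : X) 1) : (ballNhds x).NeBot := by
  have : x ∈ closure (Metric.ball (0 : X) 1) := by
    let _ : NormedSpace ℝ X := NormedSpace.restrictScalars ℝ ℂ X
    rwa [closure_ball (0 : X) one_ne_zero]
  exact mem_closure_iff_comap_neBot.1 this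

omit [NormedSpace ℂ X] in
theorem tendsto_ballNhds_of_continuousOn {F : X → ℂ}
    (hF : ContinuousOn F (Metric.closedBall (0 : X) 1)) {f : Ball X → ℂ}
    (hFf : ∀ y : Ball X, F y = f y) {x : X} (hx : x ∈ Metric.closedBall (0 : X) 1) :
    Tendsto f (ballNhds x) (𝓝 (F x)) :=
  ((hF x hx).tendsto.comp (tendsto_nhdsWithin_iff.2 ⟨tendsto_coe_ballNhds x,
    Eventually.of_forall fun y => Metric.ball_subset_closedBall y.2⟩)).congr hFf

theorem exists_tendsto_ballNhds {x : X} (hx : x ∈ Metric.closedBall (0 : X) 1) (f : AInfty X) :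
    ∃ c, Tendsto (f : Ball X →ᵇ ℂ) (ballNhds x) (𝓝 c) := by
  obtain ⟨F, hF, hFf⟩ := f.2.2
  exact ⟨F x, tendsto_ballNhds_of_continuousOn hF hFf hx⟩

/-- Evaluation at a point `x` of the closed unit ball of the continuous extensions of the members
of `A_∞(B)`. -/
def boundaryEval {x : X} (hx : x ∈ Metric.closedBall (0 : X) 1) : AInfty X →ₐ[ℂ] ℂ :=
  haveI := ballNhds_neBot hx
  have h := fun f => (exists_tendsto_ballNhds hx f).choose_spec
  AlgHom.ofLinearMap
    { toFun := fun f => (exists_tendsto_ballNhds hx f).choose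
      map_add' := fun f g => tendsto_nhds_unique (h (f + g)) ((h f).add (h g))
      map_smul' := fun c f => tendsto_nhds_unique (h (c • f)) ((h f).const_smul c) }
    (tendsto_nhds_unique (h 1) tendsto_const_nhds)
    (fun f g => tendsto_nhds_unique (h (f * g)) ((h f).mul (h g)))

theorem tendsto_boundaryEval {x : X} (hx : x ∈ Metric.closedBall (0 : X) 1) (f : AInfty X) :
    Tendsto (f : Ball X →ᵇ ℂ) (ballNhds x) (𝓝 (boundaryEval hx f)) :=
  (exists_tendsto_ballNhds hx f).choose_spec

theorem boundaryEval_add {x : X} (hx : x ∈ Metric.closedBall (0 : X) 1) (f g : AInfty X) :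
    boundaryEval hx (f + g) = boundaryEval hx f + boundaryEval hx g :=
  (boundaryEval hx).map_add' f g

theorem norm_boundaryEval_le {x : X} (hx : x ∈ Metric.closedBall (0 : X) 1) (f : AInfty X) :
    ‖boundaryEval hx f‖ ≤ ‖f‖ :=
  haveI := ballNhds_neBot hx
  le_of_tendsto (tendsto_boundaryEval hx f).norm
    (Eventually.of_forall fun y => (f : Ball X →ᵇ ℂ).norm_coe_le_norm y)

/-- Evaluation at a point of the closed unit ball, as a point of the spectrum of `A_∞(B)`. -/
def boundaryChar {x : X} (hx : x ∈ Metric.closedBall (0 : X) 1) :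
    WeakDual.characterSpace ℂ (AInfty X) :=
  ⟨StrongDual.toWeakDual ((boundaryEval hx).toLinearMap.mkContinuous 1 fun f =>
      (norm_boundaryEval_le hx f).trans_eq (one_mul _).symm),
    fun h => one_ne_zero (α := ℂ) ((map_one (boundaryEval hx)).symm.trans (DFunLike.congr_fun h 1)),
    fun f g => map_mul (boundaryEval hx) f g⟩

/-- The restriction to the open unit ball of a continuous linear functional. -/
def linearElem (φ : StrongDual ℂ X) : AInfty X :=
  ⟨BoundedContinuousFunction.ofNormedAddCommGroup (fun x : Ball X => φ (x : X))
      (φ.continuous.comp continuous_subtype_val) ‖φ‖ fun x =>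
        φ.unit_le_opNorm _ (mem_ball_zero_iff.1 x.2).le,
    IsHolomorphic.congr (F := φ) (fun _ _ => φ.analyticAt _) fun _ => rfl,
    φ, φ.continuous.continuousOn, fun _ => rfl⟩

theorem boundaryEval_linearElem {x : X} (hx : x ∈ Metric.closedBall (0 : X) 1)
    (φ : StrongDual ℂ X) : boundaryEval hx (linearElem φ) = φ x :=
  haveI := ballNhds_neBot hx
  tendsto_nhds_unique (tendsto_boundaryEval hx _)
    ((φ.continuous.tendsto x).comp (tendsto_coe_ballNhds x))

/-- A function in `A_∞(B)` bounded away from zero on the ball is invertible in `A_∞(B)`. -/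
theorem isUnit_of_le_norm (f : AInfty X) {c : ℝ} (hc : 0 < c)
    (hf : ∀ x : Ball X, c ≤ ‖(f : Ball X →ᵇ ℂ) x‖) : IsUnit f := by
  have h0 : ∀ x : Ball X, (f : Ball X →ᵇ ℂ) x ≠ 0 := fun x => norm_pos_iff.1 (hc.trans_le (hf x))
  let g : Ball X →ᵇ ℂ := BoundedContinuousFunction.ofNormedAddCommGroup
    (fun x => ((f : Ball X →ᵇ ℂ) x)⁻¹) ((f : Ball X →ᵇ ℂ).continuous.inv₀ h0) c⁻¹ fun x => by
      rw [norm_inv]; exact inv_anti₀ hc (hf x)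
  have hg : g ∈ AInfty X := by
    obtain ⟨hol, F, hF, hFf⟩ := f.2
    refine ⟨IsHolomorphic.congr (F := fun x => (zeroExt (f : Ball X →ᵇ ℂ) x)⁻¹)
      (AnalyticOnNhd.inv hol fun x hx => ?_) fun x => ?_, fun x => (F x)⁻¹,
      hF.inv₀ fun x hx => ?_, fun x => congrArg _ (hFf x)⟩
    · rw [zeroExt_of_mem _ hx]; exact h0 _
    · rw [zeroExt_of_mem _ x.2]; rfl
    · have := ballNhds_neBot hx
      have ht := tendsto_ballNhds_of_continuousOn hF hFf hx
      exact norm_pos_iff.1 (hc.trans_le (ge_of_tendsto ht.norm (Eventually.of_forall hf)))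
  refine IsUnit.of_mul_eq_one ⟨g, hg⟩ (Subtype.ext ?_)
  ext x
  exact mul_inv_cancel₀ (h0 x)

/-! ### Taylor series and the canonical image of `X` in its bidual -/

open NormedSpace in
/-- On the canonical image of `X` the Arens extension of a multilinear form is the form itself. -/
theorem arensDiag_inclusion (x : X) (n : ℕ) (A : ContinuousMultilinearMap ℂ (fun _ : Fin n => X) ℂ) :
    arensDiag (inclusionInDoubleDual ℂ X x) n A = A fun _ => x := by
  induction n with
  | zero => exact congrArg A (Subsingleton.elim _ _)
  | succ n ih =>
    refine (ih (A.curryLeft x)).trans ?_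
    rw [ContinuousMultilinearMap.curryLeft_apply]
    congr 1
    ext i
    refine Fin.cases rfl (fun _ => rfl) i

/-- A holomorphic function on the ball is the sum of its Taylor series at `0`; this is the
one-variable theorem on the complex line through the point. -/
theorem hasSum_taylor {f : Ball X → ℂ} (hf : IsHolomorphic f) (x : Ball X) :
    HasSum (fun k : ℕ => (k.factorial : ℂ)⁻¹ *
      iteratedFDeriv ℂ k (zeroExt f) 0 (fun _ => (x : X))) (f x) := by
  rcases eq_or_ne (x : X) 0 with hx | hx
  · rw [← zeroExt_of_mem f x.2, hx]
    have h := hasSum_single (f := fun k : ℕ => (k.factorial : ℂ)⁻¹ *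
      iteratedFDeriv ℂ k (zeroExt f) 0 (fun _ => (0 : X))) 0 fun k hk => by
        have : Nonempty (Fin k) := Fin.pos_iff_nonempty.1 (Nat.pos_of_ne_zero hk)
        rw [(iteratedFDeriv ℂ k (zeroExt f) 0).map_coord_zero (Classical.arbitrary _) rfl, mul_zero]
    simpa using h
  have hxn : 0 < ‖(x : X)‖ := norm_pos_iff.2 hx
  set L : ℂ →L[ℂ] X := ContinuousLinearMap.toSpanSingleton ℂ (x : X) with hL
  have hpre : L ⁻¹' Metric.ball (0 : X) 1 = Metric.ball (0 : ℂ) ‖(x : X)‖⁻¹ := by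
    ext t
    simp only [Set.mem_preimage, mem_ball_zero_iff, hL, ContinuousLinearMap.toSpanSingleton_apply,
      norm_smul]
    rw [← lt_div_iff₀ hxn, one_div]
  have hopen : IsOpen (L ⁻¹' Metric.ball (0 : X) 1) := Metric.isOpen_ball.preimage L.continuous
  have hcd : ContDiffOn ℂ ⊤ (zeroExt f) (Metric.ball (0 : X) 1) :=
    hf.contDiffOn Metric.isOpen_ball.uniqueDiffOn
  have hdiff : DifferentiableOn ℂ (zeroExt f ∘ L) (Metric.ball (0 : ℂ) ‖(x : X)‖⁻¹) := by
    rw [← hpre]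
    exact hf.differentiableOn.comp L.differentiable.differentiableOn fun _ h => h
  have hx1 : (1 : ℂ) ∈ Metric.ball (0 : ℂ) ‖(x : X)‖⁻¹ := by
    rw [mem_ball_zero_iff, norm_one]
    exact (one_lt_inv₀ hxn).2 (mem_ball_zero_iff.1 x.2)
  have h := Complex.hasSum_taylorSeries_on_ball hdiff hx1
  have hL1 : L 1 = x := by simp [hL]
  have hval : (zeroExt f ∘ L) 1 = f x := by
    rw [Function.comp_apply, hL1, zeroExt_of_mem f x.2]
  rw [hval] at h
  have hterm : ∀ k : ℕ, iteratedDeriv k (zeroExt f ∘ L) 0 =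
      iteratedFDeriv ℂ k (zeroExt f) 0 fun _ => (x : X) := by
    intro k
    have h0 : L 0 ∈ Metric.ball (0 : X) 1 := by simp
    have hk := L.iteratedFDerivWithin_comp_right hcd Metric.isOpen_ball.uniqueDiffOn
      hopen.uniqueDiffOn h0 (i := k) (by exact le_top)
    rw [iteratedFDerivWithin_of_isOpen k hopen h0,
      iteratedFDerivWithin_of_isOpen k Metric.isOpen_ball h0, map_zero] at hk
    rw [iteratedDeriv_eq_iteratedFDeriv, hk]
    simp [hL1]
  simpa [hterm] using h

end ClusterValue

namespace ClusterValue

variable {X : Type*} [NormedAddCommGroup X] [NormedSpace ℂ X]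

open NormedSpace in
/-- At a point `x` of `X` in the closed unit ball, the Aron-Berner extension of a member of
`A_∞(B)` exists and is the value at `x` of its continuous extension. -/
theorem isAronBernerValue_inclusion_iff {x : X} (hx : x ∈ Metric.closedBall (0 : X) 1)
    (f : AInfty X) (w : ℂ) :
    IsAronBernerValue (f : Ball X →ᵇ ℂ) (inclusionInDoubleDual ℂ X x) w ↔
      w = boundaryEval hx f := by
  have := ballNhds_neBot hx
  obtain ⟨hol, F, hF, hFf⟩ := f.2
  have hFx : boundaryEval hx f = F x :=
    tendsto_nhds_unique (tendsto_boundaryEval hx f) (tendsto_ballNhds_of_continuousOn hF hFf hx)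
  have hmem : ∀ r : ℝ, 0 ≤ r → r < 1 → (r : ℂ) • x ∈ Metric.ball (0 : X) 1 := by
    intro r h0 h1
    have hx1 : ‖x‖ ≤ 1 := mem_closedBall_zero_iff.1 hx
    rw [mem_ball_zero_iff, norm_smul, Complex.norm_real, Real.norm_of_nonneg h0]
    nlinarith [norm_nonneg x]
  have hsum : ∀ r : ℝ, 0 ≤ r → r < 1 →
      HasSum (fun k : ℕ => (k.factorial : ℂ)⁻¹ *
        arensDiag ((r : ℂ) • inclusionInDoubleDual ℂ X x) k
          (iteratedFDeriv ℂ k (zeroExt (f : Ball X →ᵇ ℂ)) 0)) (F ((r : ℂ) • x)) := by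
    intro r h0 h1
    simp_rw [← map_smul, arensDiag_inclusion]
    rw [hFf ⟨_, hmem r h0 h1⟩]
    exact hasSum_taylor hol ⟨_, hmem r h0 h1⟩
  have hlim : Tendsto (fun r : ℝ => F ((r : ℂ) • x)) (𝓝[<] 1) (𝓝 (F x)) := by
    refine (hF x hx).tendsto.comp (tendsto_nhdsWithin_iff.2 ⟨?_, ?_⟩)
    · have hc : Continuous fun r : ℝ => (r : ℂ) • x := by fun_prop
      simpa using (hc.tendsto 1).mono_left nhdsWithin_le_nhds
    · filter_upwards [Ico_mem_nhdsLT (zero_lt_one (α := ℝ))] with r hr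
      exact Metric.ball_subset_closedBall (hmem r hr.1 hr.2)
  constructor
  · rintro ⟨G, hG, hGw⟩
    rw [hFx]
    refine tendsto_nhds_unique hGw (hlim.congr' ?_)
    filter_upwards [Ico_mem_nhdsLT (zero_lt_one (α := ℝ))] with r hr
    exact (hsum r hr.1 hr.2).unique (hG r hr.1 hr.2)
  · rintro rfl
    exact ⟨_, hsum, hFx ▸ hlim⟩

/-! ### Cluster values at points with enough peaking functions -/

/-- Arbitrarily small balls around `x` are singled out by polynomials in continuous linear
functionals: for each `ε` there is such a polynomial `p`, vanishing at `x` and with nonnegative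
real part on the unit ball `B`, whose real part is bounded below by a positive constant at the
points of `B` at distance at least `ε` from `x`. -/
def HasPeakingPolynomials {x : X} (hx : x ∈ Metric.closedBall (0 : X) 1) : Prop :=
  ∀ ε > 0, ∃ p ∈ Algebra.adjoin ℂ (Set.range (linearElem (X := X))), ∃ δ > 0,
    boundaryEval hx p = 0 ∧ ∀ y : Ball X, 0 ≤ ((p : Ball X →ᵇ ℂ) y).re ∧
      (((p : Ball X →ᵇ ℂ) y).re < δ → ‖(y : X) - x‖ < ε)

open NormedSpace in
theorem mem_fiber_inclusion_iff (x : X) (τ : WeakDual.characterSpace ℂ (AInfty X)) :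
    τ ∈ fiber (AInfty X) (inclusionInDoubleDual ℂ X x) ↔
      ∀ φ : StrongDual ℂ X, τ (linearElem φ) = φ x := by
  refine ⟨fun h φ => h _ φ fun _ => rfl, fun h g φ hg => ?_⟩
  have : g = linearElem φ := Subtype.ext (BoundedContinuousFunction.ext hg)
  rw [this, h]; rfl

/-- The values of a character at polynomials in linear functionals are determined by its values at
linear functionals. -/
theorem apply_eq_of_mem_adjoin {x : X} (hx : x ∈ Metric.closedBall (0 : X) 1)
    {τ : WeakDual.characterSpace ℂ (AInfty X)}
    (hτ : ∀ φ : StrongDual ℂ X, τ (linearElem φ) = φ x) {p : AInfty X}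
    (hp : p ∈ Algebra.adjoin ℂ (Set.range (linearElem (X := X)))) :
    τ p = boundaryEval hx p := by
  induction hp using Algebra.adjoin_induction with
  | mem p hp => obtain ⟨φ, rfl⟩ := hp; rw [hτ, boundaryEval_linearElem]
  | algebraMap c => rw [AlgHomClass.commutes, AlgHomClass.commutes]
  | add p q _ _ hp hq => rw [map_add, boundaryEval_add, hp, hq]
  | mul p q _ _ hp hq => rw [map_mul, map_mul (boundaryEval hx), hp, hq]

theorem tendsto_of_mem_adjoin {x : X} (hx : x ∈ Metric.closedBall (0 : X) 1)
    {l : Filter (Ball X)} (hl : ∀ φ : StrongDual ℂ X, Tendsto (fun y : Ball X => φ y) l (𝓝 (φ x)))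
    {p : AInfty X} (hp : p ∈ Algebra.adjoin ℂ (Set.range (linearElem (X := X)))) :
    Tendsto (p : Ball X →ᵇ ℂ) l (𝓝 (boundaryEval hx p)) := by
  induction hp using Algebra.adjoin_induction with
  | mem p hp => obtain ⟨φ, rfl⟩ := hp; rw [boundaryEval_linearElem]; exact hl φ
  | algebraMap c => rw [AlgHomClass.commutes]; exact tendsto_const_nhds
  | add p q _ _ hp hq => rw [boundaryEval_add]; exact hp.add hq
  | mul p q _ _ hp hq => rw [map_mul (boundaryEval hx)]; exact hp.mul hq

/-- A character of `A_∞(B)` is bounded by the supremum over the ball. -/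
theorem norm_apply_le_of_forall_norm_le (τ : WeakDual.characterSpace ℂ (AInfty X)) (f : AInfty X)
    {C : ℝ} (hf : ∀ y : Ball X, ‖(f : Ball X →ᵇ ℂ) y‖ ≤ C) : ‖τ f‖ ≤ C := by
  by_contra! h
  have hu : IsUnit (algebraMap ℂ (AInfty X) (τ f) - f) :=
    isUnit_of_le_norm _ (sub_pos.2 h) fun y =>
      (sub_le_sub_left (hf y) _).trans (norm_sub_norm_le (τ f) _)
  have h0 : τ (algebraMap ℂ (AInfty X) (τ f) - f) = 0 := by
    rw [map_sub, AlgHomClass.commutes]; exact sub_self _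
  exact (hu.map τ).ne_zero h0

/-- The functions `1 / (1 + K p)`, for a peaking polynomial `p` and large `K`, have the value `1`
at every character of the fiber and are small away from `x`; multiplication by one of them makes
`f - f(x)` uniformly small. -/
theorem HasPeakingPolynomials.apply_eq {x : X} {hx : x ∈ Metric.closedBall (0 : X) 1}
    (hpeak : HasPeakingPolynomials hx) {τ : WeakDual.characterSpace ℂ (AInfty X)}
    (hτ : ∀ φ : StrongDual ℂ X, τ (linearElem φ) = φ x) (f : AInfty X) :
    τ f = boundaryEval hx f := by
  refine eq_of_forall_dist_le fun η hη => ?_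
  rw [dist_eq_norm]
  set f₀ : AInfty X := f - algebraMap ℂ (AInfty X) (boundaryEval hx f) with hf₀
  have hf₀τ : τ f₀ = τ f - boundaryEval hx f := by
    rw [hf₀, map_sub, AlgHomClass.commutes]; rfl
  have hnear : ∀ᶠ y in ballNhds x, ‖(f₀ : Ball X →ᵇ ℂ) y‖ < η := by
    have := tendsto_boundaryEval hx f₀
    rw [hf₀, map_sub, AlgHomClass.commutes] at this
    rw [← hf₀] at this
    have h := this.norm
    rw [show ‖boundaryEval hx f - algebraMap ℂ ℂ (boundaryEval hx f)‖ = 0 by simp] at h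
    exact h.eventually_lt_const hη
  obtain ⟨ε, hε, hball⟩ := (Metric.nhds_basis_ball.comap _).eventually_iff.1 hnear
  obtain ⟨p, hp, δ, hδ, hpx, hpy⟩ := hpeak ε hε
  have hτp : τ p = 0 := (apply_eq_of_mem_adjoin hx hτ hp).trans hpx
  -- With this `K`, `η * ‖1 + K p‖` dominates `f₀` wherever `re p ≥ δ`.
  set K : ℝ := ‖(f₀ : Ball X →ᵇ ℂ)‖ / (η * δ) with hK
  have hK0 : 0 ≤ K := by positivity
  set q : AInfty X := 1 + (K : ℂ) • p with hq
  have hqy : ∀ y, 1 + K * ((p : Ball X →ᵇ ℂ) y).re ≤ ‖(q : Ball X →ᵇ ℂ) y‖ := by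
    intro y
    refine le_trans (le_of_eq ?_) (Complex.re_le_norm _)
    have : (q : Ball X →ᵇ ℂ) y = 1 + (K : ℂ) * (p : Ball X →ᵇ ℂ) y := rfl
    simp [this]
  have hq1 : ∀ y, 1 ≤ ‖(q : Ball X →ᵇ ℂ) y‖ := fun y =>
    le_trans (by nlinarith [mul_nonneg hK0 (hpy y).1]) (hqy y)
  obtain ⟨g, hg⟩ := (isUnit_of_le_norm q one_pos hq1).exists_right_inv
  have hτg : τ g = 1 := by
    have h := congrArg τ hg
    rwa [map_mul, hq, map_add, map_smul, hτp, smul_zero, add_zero, map_one, one_mul] at h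
  have hgy : ∀ y, ‖(q : Ball X →ᵇ ℂ) y‖ * ‖(g : Ball X →ᵇ ℂ) y‖ = 1 := by
    intro y
    have h : (q : Ball X →ᵇ ℂ) y * (g : Ball X →ᵇ ℂ) y = 1 :=
      congrArg (fun u : AInfty X => (u : Ball X →ᵇ ℂ) y) hg
    rw [← norm_mul, h, norm_one]
  have hbound : ∀ y, ‖((g * f₀ : AInfty X) : Ball X →ᵇ ℂ) y‖ ≤ η := by
    intro y
    have hmul : ((g * f₀ : AInfty X) : Ball X →ᵇ ℂ) y =
      (g : Ball X →ᵇ ℂ) y * (f₀ : Ball X →ᵇ ℂ) y := rfl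
    have hf₀y : ‖(f₀ : Ball X →ᵇ ℂ) y‖ ≤ η * ‖(q : Ball X →ᵇ ℂ) y‖ := by
      rcases lt_or_ge ((p : Ball X →ᵇ ℂ) y).re δ with h | h
      · have hy : ‖(f₀ : Ball X →ᵇ ℂ) y‖ < η :=
          hball (by simpa [dist_eq_norm] using (hpy y).2 h)
        nlinarith [hq1 y]
      · have h1 : ‖(f₀ : Ball X →ᵇ ℂ)‖ = η * (K * δ) := by rw [hK]; field_simp
        have h2 := (f₀ : Ball X →ᵇ ℂ).norm_coe_le_norm y
        have h3 : K * δ ≤ ‖(q : Ball X →ᵇ ℂ) y‖ := by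
          nlinarith [hqy y, mul_le_mul_of_nonneg_left h hK0]
        rw [h1] at h2
        exact h2.trans (mul_le_mul_of_nonneg_left h3 hη.le)
    rw [hmul, norm_mul]
    calc _ ≤ ‖(g : Ball X →ᵇ ℂ) y‖ * (η * ‖(q : Ball X →ᵇ ℂ) y‖) := by gcongr
      _ = η * (‖(q : Ball X →ᵇ ℂ) y‖ * ‖(g : Ball X →ᵇ ℂ) y‖) := by ring
      _ = η := by rw [hgy, mul_one]
  have := norm_apply_le_of_forall_norm_le τ _ hbound
  rwa [map_mul, hτg, one_mul, hf₀τ] at this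

/-- Weak convergence to `x` within the ball is norm convergence. -/
theorem HasPeakingPolynomials.le_ballNhds {x : X} {hx : x ∈ Metric.closedBall (0 : X) 1}
    (hpeak : HasPeakingPolynomials hx) {l : Filter (Ball X)}
    (hl : ∀ φ : StrongDual ℂ X, Tendsto (fun y : Ball X => φ y) l (𝓝 (φ x))) :
    l ≤ ballNhds x := by
  refine (Metric.nhds_basis_ball.comap _).ge_iff.2 fun ε hε => ?_
  obtain ⟨p, hp, δ, hδ, hpx, hpy⟩ := hpeak ε hε
  have ht := (Complex.continuous_re.tendsto _).comp (tendsto_of_mem_adjoin hx hl hp)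
  rw [hpx] at ht
  filter_upwards [ht.eventually_lt_const (show (0 : ℂ).re < δ from hδ)] with y hy
  simpa [dist_eq_norm] using (hpy y).2 hy

theorem continuous_eval (P : ContPolynomial X) : Continuous P.eval := by
  unfold ContPolynomial.eval
  exact continuous_finsetSum _ fun k _ => (P.form k).cont.comp (continuous_pi fun _ => continuous_id)

open NormedSpace in
theorem aronBerner_inclusion (P : ContPolynomial X) (x : X) :
    P.aronBerner (inclusionInDoubleDual ℂ X x) = P.eval x :=
  Finset.sum_congr rfl fun _ _ => arensDiag_inclusion x _ _

/-- A continuous linear functional as a continuous polynomial. -/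
def linearPolynomial (φ : StrongDual ℂ X) : ContPolynomial X where
  degBound := 1
  form
    | 1 => (ContinuousMultilinearMap.ofSubsingleton ℂ X ℂ (0 : Fin 1)) φ
    | _ => 0
  symm k σ v := by
    match k with
    | 0 => rfl
    | 1 => rw [Subsingleton.elim σ 1]; rfl
    | _ + 2 => rfl

theorem eval_linearPolynomial (φ : StrongDual ℂ X) (x : X) :
    (linearPolynomial φ).eval x = φ x := by
  simp [ContPolynomial.eval, linearPolynomial, Finset.sum_range_succ]

section

open NormedSpace

variable {x : X} {hx : x ∈ Metric.closedBall (0 : X) 1}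

theorem boundaryEval_mem_polyClusterSet (hx : x ∈ Metric.closedBall (0 : X) 1) (f : AInfty X) :
    boundaryEval hx f ∈ polyClusterSet (f : Ball X →ᵇ ℂ) (inclusionInDoubleDual ℂ X x) := by
  refine ⟨ballNhds x, ballNhds_neBot hx, fun P => ?_, tendsto_boundaryEval hx f⟩
  rw [aronBerner_inclusion]
  exact ((continuous_eval P).tendsto x).comp (tendsto_coe_ballNhds x)

theorem polyClusterSet_subset_clusterSet (f : Ball X → ℂ) (x : X) :
    polyClusterSet f (inclusionInDoubleDual ℂ X x) ⊆
      clusterSet f (inclusionInDoubleDual ℂ X x) := by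
  rintro c ⟨l, hl, hP, hc⟩
  refine ⟨l, hl, fun φ => ?_, hc⟩
  have h := hP (linearPolynomial φ)
  simp_rw [aronBerner_inclusion, eval_linearPolynomial] at h
  exact h

theorem isAu_linearElem (φ : StrongDual ℂ X) : IsAu (linearElem φ : Ball X →ᵇ ℂ) :=
  ⟨(linearElem φ).2.1, φ.uniformContinuous.comp uniformContinuous_subtype_val⟩

theorem polyFiber_subset_fiber (hx : x ∈ Metric.closedBall (0 : X) 1) :
    polyFiber (AInfty X) (inclusionInDoubleDual ℂ X x) ⊆
      fiber (AInfty X) (inclusionInDoubleDual ℂ X x) := by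
  intro τ hτ
  refine (mem_fiber_inclusion_iff x τ).2 fun φ => ?_
  rw [(isAronBernerValue_inclusion_iff hx _ _).1 (hτ _ (isAu_linearElem φ)),
    boundaryEval_linearElem]

theorem boundaryChar_mem_polyFiber (hx : x ∈ Metric.closedBall (0 : X) 1) :
    boundaryChar hx ∈ polyFiber (AInfty X) (inclusionInDoubleDual ℂ X x) :=
  fun g _ => (isAronBernerValue_inclusion_iff hx g _).2 rfl

theorem HasPeakingPolynomials.clusterSet_subset (hpeak : HasPeakingPolynomials hx)
    (f : AInfty X) :
    clusterSet (f : Ball X →ᵇ ℂ) (inclusionInDoubleDual ℂ X x) ⊆ {boundaryEval hx f} := by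
  rintro c ⟨l, hl, hφ, hc⟩
  exact tendsto_nhds_unique hc ((tendsto_boundaryEval hx f).mono_left (hpeak.le_ballNhds hφ))

theorem HasPeakingPolynomials.image_fiber_subset (hpeak : HasPeakingPolynomials hx)
    (f : AInfty X) :
    WeakDual.gelfandTransform ℂ (AInfty X) f '' fiber (AInfty X) (inclusionInDoubleDual ℂ X x) ⊆
      {boundaryEval hx f} := by
  rintro _ ⟨τ, hτ, rfl⟩
  exact hpeak.apply_eq ((mem_fiber_inclusion_iff x τ).1 hτ) f

/-- All four sets in the two cluster value theorems are the singleton of the boundary value. -/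
theorem HasPeakingPolynomials.clusterValueTheorems (hpeak : HasPeakingPolynomials hx) :
    PolyClusterValueTheoremAt (AInfty X) (inclusionInDoubleDual ℂ X x) ∧
      ClusterValueTheoremAt (AInfty X) (inclusionInDoubleDual ℂ X x) := by
  have hcl : ∀ f : AInfty X, ∀ {S : Set ℂ}, S ⊆ {boundaryEval hx f} → boundaryEval hx f ∈ S →
      S = {boundaryEval hx f} := fun f S h₁ h₂ => h₁.antisymm (Set.singleton_subset_iff.2 h₂)
  have himage := fun f : AInfty X => Set.mem_image_of_mem
    (WeakDual.gelfandTransform ℂ (AInfty X) f) (boundaryChar_mem_polyFiber hx)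
  refine ⟨fun f => ?_, fun f => ?_⟩
  · rw [hcl f ((polyClusterSet_subset_clusterSet _ x).trans (hpeak.clusterSet_subset f))
      (boundaryEval_mem_polyClusterSet hx f)]
    exact (hcl f ((Set.image_mono (polyFiber_subset_fiber hx)).trans
      (hpeak.image_fiber_subset f)) (himage f)).symm
  · rw [hcl f (hpeak.clusterSet_subset f)
      (polyClusterSet_subset_clusterSet _ x (boundaryEval_mem_polyClusterSet hx f))]
    exact (hcl f (hpeak.image_fiber_subset f)
      (Set.image_mono (polyFiber_subset_fiber hx) (himage f))).symm

end

end ClusterValue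

/-! ### Peaking polynomials on `ℓ_1` -/

namespace EllOne

section Sequences

variable {u : ℕ → ℂ} {t : ℕ → ℝ}

/-- The key inequality. The squares contribute `-(im u n)²` to the real part, and this is absorbed
by `1 - ∑ re u n ≥ ∑ (‖u n‖ - re u n)`, because
`(im u n)² = (‖u n‖ - re u n) (‖u n‖ + re u n) ≤ 2 (‖u n‖ - re u n)`. -/
theorem half_add_quarter_le_re (hu : Summable fun n => ‖u n‖) (hu1 : ∑' n, ‖u n‖ ≤ 1) (N : ℕ) :
    (1 - ∑' n, (u n).re) / 2 + (∑ n ∈ Finset.range N, ((u n).re - t n) ^ 2) / 4 ≤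
      (1 - ∑' n, u n + 1 / 4 * ∑ n ∈ Finset.range N, (u n - t n) ^ 2).re := by
  have hre : Summable fun n => (u n).re :=
    .of_norm_bounded hu fun n => Complex.abs_re_le_norm (u n)
  have hle1 : ∀ n, ‖u n‖ ≤ 1 := fun n =>
    (hu.le_tsum n fun _ _ => norm_nonneg _).trans hu1
  have him : ∀ n, (u n).im ^ 2 ≤ 2 * (‖u n‖ - (u n).re) := fun n => by
    have h1 := Complex.sq_norm (u n)
    rw [Complex.normSq_apply] at h1
    have h2 := Complex.re_le_norm (u n)
    nlinarith [hle1 n, mul_nonneg (sub_nonneg.2 h2) (sub_nonneg.2 (h2.trans (hle1 n))),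
      mul_nonneg (sub_nonneg.2 h2) (sub_nonneg.2 (hle1 n))]
  have hsum : ∑ n ∈ Finset.range N, (u n).im ^ 2 ≤ 2 * (1 - ∑' n, (u n).re) :=
    calc ∑ n ∈ Finset.range N, (u n).im ^ 2
        ≤ ∑ n ∈ Finset.range N, 2 * (‖u n‖ - (u n).re) := Finset.sum_le_sum fun n _ => him n
      _ = 2 * ∑ n ∈ Finset.range N, (‖u n‖ - (u n).re) := by rw [Finset.mul_sum]
      _ ≤ 2 * ∑' n, (‖u n‖ - (u n).re) := by
          gcongr
          exact (hu.sub hre).sum_le_tsum _ fun n _ => sub_nonneg.2 (Complex.re_le_norm _)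
      _ ≤ 2 * (1 - ∑' n, (u n).re) := by rw [hu.tsum_sub hre]; gcongr
  have hsq : ∀ n, ((u n - t n) ^ 2).re = ((u n).re - t n) ^ 2 - (u n).im ^ 2 := fun n => by
    simp [pow_two]
  have hval : (1 - ∑' n, u n + 1 / 4 * ∑ n ∈ Finset.range N, (u n - t n) ^ 2).re =
      1 - ∑' n, (u n).re + 1 / 4 * (∑ n ∈ Finset.range N, ((u n).re - t n) ^ 2 -
        ∑ n ∈ Finset.range N, (u n).im ^ 2) := by
    rw [← Finset.sum_sub_distrib, ← Finset.sum_congr rfl fun n _ => hsq n, ← Complex.re_sum,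
      Complex.add_re, Complex.sub_re, Complex.one_re, Complex.re_tsum hu.of_norm,
      show (1 / 4 : ℂ) = ((1 / 4 : ℝ) : ℂ) by norm_num, Complex.re_ofReal_mul]
  rw [hval]
  linarith

theorem tsum_re_le_one (hu : Summable fun n => ‖u n‖) (hu1 : ∑' n, ‖u n‖ ≤ 1) :
    ∑' n, (u n).re ≤ 1 :=
  ((Summable.of_norm_bounded hu fun n => Complex.abs_re_le_norm (u n)).tsum_le_tsum
    (fun n => Complex.re_le_norm (u n)) hu).trans hu1

theorem norm_sub_sq_le_re (hu : Summable fun n => ‖u n‖) (hu1 : ∑' n, ‖u n‖ ≤ 1)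
    {N n : ℕ} (hn : n < N) :
    ‖u n - t n‖ ^ 2 ≤
      8 * (1 - ∑' n, u n + 1 / 4 * ∑ n ∈ Finset.range N, (u n - t n) ^ 2).re := by
  refine le_trans ?_ (mul_le_mul_of_nonneg_left (half_add_quarter_le_re hu hu1 N) (by norm_num))
  have hre : Summable fun n => (u n).re :=
    .of_norm_bounded hu fun n => Complex.abs_re_le_norm (u n)
  have hle1 : ‖u n‖ ≤ 1 := (hu.le_tsum n fun _ _ => norm_nonneg _).trans hu1
  have h1 := Complex.sq_norm (u n)
  rw [Complex.normSq_apply] at h1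
  have h2 := Complex.re_le_norm (u n)
  have h3 : ‖u n‖ - (u n).re ≤ 1 - ∑' n, (u n).re :=
    calc ‖u n‖ - (u n).re ≤ ∑' n, (‖u n‖ - (u n).re) :=
          (hu.sub hre).le_tsum n fun m _ => sub_nonneg.2 (Complex.re_le_norm _)
      _ ≤ 1 - ∑' n, (u n).re := by rw [hu.tsum_sub hre]; gcongr
  have h4 : ((u n).re - t n) ^ 2 ≤ ∑ n ∈ Finset.range N, ((u n).re - t n) ^ 2 :=
    Finset.single_le_sum (f := fun n => ((u n).re - t n) ^ 2) (fun m _ => sq_nonneg _)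
      (Finset.mem_range.2 hn)
  have h5 : ‖u n - t n‖ ^ 2 = ((u n).re - t n) ^ 2 + (u n).im ^ 2 := by
    rw [Complex.sq_norm, Complex.normSq_apply]; simp; ring
  have h6 : 0 ≤ ((u n).re - t n) ^ 2 := sq_nonneg _
  have h7 := tsum_re_le_one hu hu1
  nlinarith [mul_nonneg (sub_nonneg.2 h2) (sub_nonneg.2 (h2.trans hle1)),
      mul_nonneg (sub_nonneg.2 h2) (sub_nonneg.2 hle1)]

/-- Since `t` carries the whole mass `1` available to `u`, closeness on the first `N` coordinates
controls the tail of `u`, hence the distance in `ℓ_1`. -/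
theorem tsum_norm_sub_le (hu : Summable fun n => ‖u n‖) (hu1 : ∑' n, ‖u n‖ ≤ 1)
    (ht0 : ∀ n, 0 ≤ t n) (ht : HasSum t 1) (N : ℕ) :
    ∑' n, ‖u n - t n‖ ≤
      2 * ∑ n ∈ Finset.range N, ‖u n - t n‖ + 2 * (1 - ∑ n ∈ Finset.range N, t n) := by
  have hpt : ∀ n, ‖u n - t n‖ ≤ ‖u n‖ + t n := fun n =>
    (norm_sub_le _ _).trans_eq (by rw [Complex.norm_real, Real.norm_of_nonneg (ht0 n)])
  have hpt' : ∀ n, t n - ‖u n‖ ≤ ‖u n - t n‖ := fun n => by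
    have := norm_sub_norm_le (t n : ℂ) (u n)
    rwa [Complex.norm_real, Real.norm_of_nonneg (ht0 n), norm_sub_rev] at this
  have hs : Summable fun n => ‖u n - t n‖ :=
    .of_nonneg_of_le (fun _ => norm_nonneg _) hpt (hu.add ht.summable)
  have h1 := hs.sum_add_tsum_nat_add N
  have h2 := hu.sum_add_tsum_nat_add N
  have h3 := ht.summable.sum_add_tsum_nat_add N
  rw [ht.tsum_eq] at h3
  have h4 : ∑' n, ‖u (n + N) - t (n + N)‖ ≤ ∑' n, ‖u (n + N)‖ + ∑' n, t (n + N) := by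
    rw [← ((summable_nat_add_iff N).2 hu).tsum_add ((summable_nat_add_iff N).2 ht.summable)]
    exact ((summable_nat_add_iff N).2 hs).tsum_le_tsum (fun n => hpt _)
      (((summable_nat_add_iff N).2 hu).add ((summable_nat_add_iff N).2 ht.summable))
  have h5 : ∑ n ∈ Finset.range N, t n - ∑ n ∈ Finset.range N, ‖u n‖ ≤
      ∑ n ∈ Finset.range N, ‖u n - t n‖ := by
    rw [← Finset.sum_sub_distrib]; exact Finset.sum_le_sum fun n _ => hpt' n
  linarith

end Sequences

end EllOne

theorem EllOne.hasSum_norm (y : EllOne) : HasSum (fun n => ‖y n‖) ‖y‖ := by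
  simpa using lp.hasSum_norm (by simp) y

/-- The functional `y ↦ ∑ c n * y n` on `ℓ_1` attached to a sequence `c` of unimodular numbers. -/
def EllOne.pairing (c : ℕ → ℂ) (hc : ∀ n, ‖c n‖ = 1) : StrongDual ℂ EllOne :=
  have hs : ∀ y : EllOne, Summable fun n => ‖c n * y n‖ := fun y => by
    simpa [hc] using (EllOne.hasSum_norm y).summable
  LinearMap.mkContinuous
    { toFun := fun y => ∑' n, c n * y n
      map_add' := fun y z => by
        rw [← (hs y).of_norm.tsum_add (hs z).of_norm]
        exact tsum_congr fun n => mul_add _ _ _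
      map_smul' := fun a y => by
        rw [RingHom.id_apply, smul_eq_mul, ← tsum_mul_left]
        exact tsum_congr fun n => mul_left_comm _ _ _ }
    1 fun y => by
      refine (norm_tsum_le_tsum_norm (hs y)).trans_eq ?_
      simpa [hc] using (EllOne.hasSum_norm y).tsum_eq

open ClusterValue in
/-- Every unit vector `x` of `ℓ_1` has peaking polynomials. With `c n` unimodular such that
`c n * x n = ‖x n‖`, the functional `∑ c n * y n` peaks on a face of the ball containing `x`, and
the squares of `c n * y n - ‖x n‖`, which are nonnegative on that face, single out `x` in it. -/
theorem EllOne.hasPeakingPolynomials {x : EllOne} (hx : ‖x‖ = 1) :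
    HasPeakingPolynomials (x := x) (mem_closedBall_zero_iff.2 hx.le) := by
  intro ε hε
  -- `N` is chosen so that the tail of `x` weighs at most `ε / 4`; the tail of a nearby `y` then
  -- contributes about as much, and the first `N` coordinates are made `ε / (4 * (N + 1))`-close.
  choose c hc hcx using fun n => RCLike.exists_norm_eq_mul_self (x n)
  have ht : HasSum (fun n => ‖x n‖) 1 := hx ▸ EllOne.hasSum_norm x
  obtain ⟨N, hN⟩ := (ht.tendsto_sum_nat.eventually_const_lt
    (show 1 - ε / 4 < 1 by linarith)).exists
  let ψ : ℕ → StrongDual ℂ EllOne := fun n => c n • lp.evalCLM ℂ (fun _ : ℕ => ℂ) 1 n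
  have hψ : ∀ n (y : EllOne), ψ n y = c n * y n := fun _ _ => rfl
  let P : EllOne → ℂ := fun y => 1 - EllOne.pairing c hc y +
    1 / 4 * ∑ n ∈ Finset.range N, (ψ n y - (‖x n‖ : ℝ)) ^ 2
  let p : AInfty EllOne := 1 - linearElem (EllOne.pairing c hc) + algebraMap ℂ _ (1 / 4) *
    ∑ n ∈ Finset.range N, (linearElem (ψ n) - algebraMap ℂ _ ((‖x n‖ : ℝ) : ℂ)) ^ 2
  have hlin : ∀ φ : StrongDual ℂ EllOne,
      linearElem φ ∈ Algebra.adjoin ℂ (Set.range (linearElem (X := EllOne))) := fun φ =>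
    Algebra.subset_adjoin ⟨φ, rfl⟩
  have hp : p ∈ Algebra.adjoin ℂ (Set.range (linearElem (X := EllOne))) :=
    add_mem (sub_mem (one_mem _) (hlin _)) (mul_mem (Subalgebra.algebraMap_mem _ _)
      (sum_mem fun n _ => pow_mem (sub_mem (hlin _) (Subalgebra.algebraMap_mem _ _)) 2))
  have hpP : ∀ y : Ball EllOne, (p : Ball EllOne →ᵇ ℂ) y = P y := by
    intro y
    have hsum : ((∑ n ∈ Finset.range N, (linearElem (ψ n) -
        algebraMap ℂ (AInfty EllOne) ((‖x n‖ : ℝ) : ℂ)) ^ 2 : AInfty EllOne) :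
          Ball EllOne →ᵇ ℂ) y = ∑ n ∈ Finset.range N, (ψ n y - (‖x n‖ : ℝ)) ^ 2 := by
      rw [AddSubmonoidClass.coe_finsetSum, BoundedContinuousFunction.coe_sum, Finset.sum_apply]
      rfl
    change 1 - EllOne.pairing c hc y + 1 / 4 * _ = _
    rw [hsum]
  have hPval : ∀ y : EllOne, P y = 1 - ∑' n, c n * y n +
      1 / 4 * ∑ n ∈ Finset.range N, (c n * y n - (‖x n‖ : ℝ)) ^ 2 := fun y => rfl
  have hPx : P x = 0 := by
    have h1 : ∑' n, c n * x n = 1 := by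
      simp_rw [← hcx]
      simpa using (Complex.hasSum_ofReal.2 ht).tsum_eq
    rw [hPval, h1]
    simp [← hcx]
  have hPc : Continuous P := by fun_prop
  have hxb : x ∈ Metric.closedBall (0 : EllOne) 1 := mem_closedBall_zero_iff.2 hx.le
  set η : ℝ := ε / (4 * (N + 1)) with hη
  have hη0 : 0 < η := by positivity
  refine ⟨p, hp, η ^ 2 / 8, by positivity, ?_, fun y => ?_⟩
  · have := ballNhds_neBot hxb
    rw [← hPx]
    exact tendsto_nhds_unique (tendsto_boundaryEval hxb p)
      (tendsto_ballNhds_of_continuousOn hPc.continuousOn (fun y => (hpP y).symm) hxb)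
  have hu : HasSum (fun n => ‖c n * (y : EllOne) n‖) ‖(y : EllOne)‖ := by
    simpa [hc] using EllOne.hasSum_norm (y : EllOne)
  have hu1 : ∑' n, ‖c n * (y : EllOne) n‖ ≤ 1 := by
    rw [hu.tsum_eq]; exact (mem_ball_zero_iff.1 y.2).le
  rw [hpP, hPval]
  refine ⟨le_trans ?_ (half_add_quarter_le_re hu.summable hu1 N), fun hlt => ?_⟩
  · have h1 := tsum_re_le_one hu.summable hu1
    have h2 : 0 ≤ ∑ n ∈ Finset.range N, ((c n * (y : EllOne) n).re - ‖x n‖) ^ 2 :=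
      Finset.sum_nonneg fun _ _ => sq_nonneg _
    linarith
  have hdist : ‖(y : EllOne) - x‖ = ∑' n, ‖c n * (y : EllOne) n - (‖x n‖ : ℝ)‖ := by
    rw [← (EllOne.hasSum_norm _).tsum_eq]
    refine tsum_congr fun n => ?_
    have h : c n * (y : EllOne) n - (‖x n‖ : ℝ) = c n * ((y : EllOne) n - x n) := by
      rw [mul_sub, ← hcx]; rfl
    rw [h, norm_mul, hc, one_mul]; rfl
  have hcoord : ∀ n ∈ Finset.range N, ‖c n * (y : EllOne) n - (‖x n‖ : ℝ)‖ ≤ η := fun n hn =>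
    le_of_sq_le_sq (by
      have := norm_sub_sq_le_re (t := fun n => ‖x n‖) hu.summable hu1 (Finset.mem_range.1 hn)
      linarith) hη0.le
  have hfin := Finset.sum_le_card_nsmul _ _ _ hcoord
  rw [Finset.card_range, nsmul_eq_mul] at hfin
  have hNη : N * η ≤ ε / 4 := by
    have : (N + 1) * η = ε / 4 := by rw [hη]; field_simp
    nlinarith
  have := tsum_norm_sub_le hu.summable hu1 (fun n => norm_nonneg (x n)) ht N
  rw [hdist]
  linarith

end

theorem corollary4p10 (x : EllOne) (hx : x ∈ Metric.sphere (0 : EllOne) 1) :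
    ClusterValue.PolyClusterValueTheoremAt (ClusterValue.AInfty EllOne)
        (NormedSpace.inclusionInDoubleDual ℂ EllOne x) ∧
      ClusterValue.ClusterValueTheoremAt (ClusterValue.AInfty EllOne)
        (NormedSpace.inclusionInDoubleDual ℂ EllOne x) :=
  (EllOne.hasPeakingPolynomials (mem_sphere_zero_iff_norm.1 hx)).clusterValueTheorems
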